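/- Let $\widetilde{\mathcal G}$ be the complex Lie algebra with basis $\{L_m,H_m,I_m,J_m,C_1,C_2,C_3 : m\in\mathbb Z\}$ and, for all $m,n\in\mathbb Z$, brackets $$[L_n,L_m]=(m-n)L_{m+n}+n^3\delta_{m+n,0}C_1,\quad [L_n,H_m]=mH_{m+n}+n^2\delta_{m+n,0}C_2,\quad [H_n,H_m]=n\delta_{m+n,0}C_3,$$ $$[L_n,I_m]=(m-n)I_{m+n},\quad [L_n,J_m]=(m-n)J_{m+n},\quad [H_n,I_m]=I_{m+n},\quad [H_n,J_m]=-J_{m+n},$$ all other brackets of basis vectors being zero (up to antisymmetry). Let $\mathcal G$ (the planar Galilean conformal algebra) be the complex Lie algebra with basis $\{L_m,H_m,I_m,J_m : m\in\mathbb Z\}$ and the same brackets with the terms in $C_1,C_2,C_3$ omitted. Let $\mathcal G^+$ be the span of the $L_m,H_m,I_m,J_m$ with $m\ge 1$ in $\mathcal G$, and $\widetilde{\mathcal G}^+$ the span of the same vectors in $\widetilde{\mathcal G}$; these are subalgebras, and they are identified with each other through these bases. For a Lie algebra homomorphism $\phi:\mathcal G^+=\widetilde{\mathcal G}^+\to\mathbb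 C$ let $\mathbb C_\phi=\mathbb C w_\phi$ be the one-dimensional module with $xw_\phi=\phi(x)w_\phi$, and put $$M(\phi)=U(\mathcal G)\otimes_{U(\mathcal G^+)}\mathbb C_\phi,\qquad \widetilde M(\phi)=U(\widetilde{\mathcal G})\otimes_{U(\widetilde{\mathcal G}^+)}\mathbb C_\phi,$$ where $U(\cdot)$ denotes the universal enveloping algebra. For $\xi=(\xi_1,\xi_2,\xi_3)\in\mathbb C^3$ put $$\widetilde L_{\phi,\xi}=\widetilde M(\phi)\Big/\sum_{s=1}^3(C_s-\xi_s)\widetilde M(\phi).$$ Let $\phi,\phi':\mathcal G^+=\widetilde{\mathcal G}^+\to\mathbb C$ be Lie algebra homomorphisms and $\xi,\xi'\in\mathbb C^3$. Then: (i) $M(\phi)\cong M(\phi')$ as $\mathcal G$-modules if and only if $\phi=\phi'$. (ii) $\widetilde M(\phi)\cong\widetilde M(\phi')$ as $\widetilde{\mathcal G}$-modules if and only if $\phi=\phi'$. (iii) $\widetilde L_{\phi,\xi}\cong\widetilde L_{\phi',\xi'}$ as $\widetilde{\mathcal G}$-modules if and only if $\phi=\phi'$ and $\xi=\xi'$. 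-/

import Mathlib

open scoped TensorProduct

noncomputable section

/-! ## Lie algebras given by structure constants -/

section StructureConstants

variable {ι : Type}

/-- The bilinear map on the complex vector space with basis `ι` whose value on the pair of basis
vectors `(a, b)` is `c a b`. -/
def structureBracket (c : ι → ι → (ι →₀ ℂ)) : (ι →₀ ℂ) →ₗ[ℂ] (ι →₀ ℂ) →ₗ[ℂ] (ι →₀ ℂ) :=
  Finsupp.basisSingleOne.constr ℂ fun a => Finsupp.basisSingleOne.constr ℂ fun b => c a b

theorem structureBracket_single (c : ι → ι → (ι →₀ ℂ)) (a b : ι) :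
    structureBracket c (Finsupp.single a 1) (Finsupp.single b 1) = c a b := by
  have h (i : ι) : (Finsupp.single i (1 : ℂ)) = Finsupp.basisSingleOne (R := ℂ) i := by simp
  rw [structureBracket, h, h, Module.Basis.constr_basis, Module.Basis.constr_basis]

theorem structureBracket_self (c : ι → ι → (ι →₀ ℂ)) (hc : ∀ a b, c a b = -c b a) (x : ι →₀ ℂ) :
    structureBracket c x x = 0 := by
  have h (y z : ι →₀ ℂ) : structureBracket c y z = -structureBracket c z y := by
    induction y using Finsupp.induction_linear with
    | zero => simp
    | add f g hf hg => simp only [map_add, LinearMap.add_apply, hf, hg]; abel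
    | single a r =>
      induction z using Finsupp.induction_linear with
      | zero => simp
      | add f g hf hg => simp only [map_add, LinearMap.add_apply, hf, hg]; abel
      | single b s =>
        have e (i : ι) (u : ℂ) : Finsupp.single i u = u • Finsupp.single i (1 : ℂ) := by simp
        rw [e a r, e b s]
        simp only [map_smul, LinearMap.smul_apply, structureBracket_single]
        rw [hc a b]
        module
  exact self_eq_neg.mp (h x x)

theorem structureBracket_jacobi (c : ι → ι → (ι →₀ ℂ))
    (hc : ∀ a b d, structureBracket c (Finsupp.single a 1) (c b d) =
      structureBracket c (c a b) (Finsupp.single d 1) +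
        structureBracket c (Finsupp.single b 1) (c a d)) (x y z : ι →₀ ℂ) :
    structureBracket c x (structureBracket c y z) =
      structureBracket c (structureBracket c x y) z +
        structureBracket c y (structureBracket c x z) := by
  induction x using Finsupp.induction_linear with
  | zero => simp
  | add f g hf hg => simp only [map_add, LinearMap.add_apply, hf, hg]; abel
  | single a r =>
    induction y using Finsupp.induction_linear with
    | zero => simp
    | add f g hf hg => simp only [map_add, LinearMap.add_apply, hf, hg]; abel
    | single b s =>
      induction z using Finsupp.induction_linear with
      | zero => simp
      | add f g hf hg => simp only [map_add, hf, hg]; abel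
      | single d t =>
        have e (i : ι) (u : ℂ) : Finsupp.single i u = u • Finsupp.single i (1 : ℂ) := by simp
        rw [e a r, e b s, e d t]
        simp only [map_smul, LinearMap.smul_apply, structureBracket_single]
        rw [hc]
        module

end StructureConstants

/-! ## The planar Galilean conformal algebra -/

/-- Labels of the basis vectors `L m`, `H m`, `I m`, `J m` (`m ∈ ℤ`). -/
inductive PGIndex : Type
  | L (m : ℤ)
  | H (m : ℤ)
  | I (m : ℤ)
  | J (m : ℤ)

/-- The complex vector space with basis `L m`, `H m`, `I m`, `J m`, `m ∈ ℤ`. -/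
def PG : Type := PGIndex →₀ ℂ

namespace PG

instance : AddCommGroup PG := inferInstanceAs (AddCommGroup (PGIndex →₀ ℂ))

instance : Module ℂ PG := inferInstanceAs (Module ℂ (PGIndex →₀ ℂ))

/-- The basis vectors. -/
def e (a : PGIndex) : PGIndex →₀ ℂ := Finsupp.single a 1

/-- The brackets of the basis vectors. -/
def br : PGIndex → PGIndex → (PGIndex →₀ ℂ)
  | .L n, .L m => ((m : ℂ) - n) • e (.L (m + n))
  | .L n, .H m => (m : ℂ) • e (.H (m + n))
  | .L n, .I m => ((m : ℂ) - n) • e (.I (m + n))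
  | .L n, .J m => ((m : ℂ) - n) • e (.J (m + n))
  | .H n, .L m => -((n : ℂ) • e (.H (n + m)))
  | .H _, .H _ => 0
  | .H n, .I m => e (.I (m + n))
  | .H n, .J m => -e (.J (m + n))
  | .I n, .L m => -(((n : ℂ) - m) • e (.I (n + m)))
  | .I n, .H m => -e (.I (n + m))
  | .I _, .I _ => 0
  | .I _, .J _ => 0
  | .J n, .L m => -(((n : ℂ) - m) • e (.J (n + m)))
  | .J n, .H m => e (.J (n + m))
  | .J _, .I _ => 0
  | .J _, .J _ => 0

theorem br_skew (a b : PGIndex) : br a b = -br b a := by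
  cases a <;> cases b <;> simp only [br, neg_neg, neg_zero]
  rename_i m n
  rw [add_comm]
  module

theorem br_jacobi (a b d : PGIndex) :
    structureBracket br (Finsupp.single a 1) (br b d) =
      structureBracket br (br a b) (Finsupp.single d 1) +
        structureBracket br (Finsupp.single b 1) (br a d) := by
  cases a <;> cases b <;> cases d <;>
    simp only [br, e, map_smul, map_neg, map_zero, LinearMap.smul_apply, LinearMap.neg_apply,
      LinearMap.zero_apply, structureBracket_single] <;>
    (try simp only [add_comm, add_left_comm, Int.cast_add]) <;> module

instance : LieRing PG where
  bracket x y := structureBracket br x y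
  add_lie x y z := LinearMap.map_add₂ (structureBracket br) x y z
  lie_add x y z := map_add (structureBracket br x) y z
  lie_self x := structureBracket_self br br_skew x
  leibniz_lie x y z := structureBracket_jacobi br br_jacobi x y z

instance : LieAlgebra ℂ PG where
  lie_smul t x y := map_smul (structureBracket br x) t y

/-- The basis vectors as elements of the Lie algebra. -/
def vec (a : PGIndex) : PG := e a

/-- The basis vector `L m`. -/
def L (m : ℤ) : PG := vec (.L m)

/-- The basis vector `H m`. -/
def H (m : ℤ) : PG := vec (.H m)

/-- The basis vector `I m`. -/
def I (m : ℤ) : PG := vec (.I m)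

/-- The basis vector `J m`. -/
def J (m : ℤ) : PG := vec (.J m)

theorem lie_vec (a b : PGIndex) : ⁅vec a, vec b⁆ = (br a b : PG) :=
  structureBracket_single br a b

theorem lie_LL (n m : ℤ) : ⁅L n, L m⁆ = ((m : ℂ) - n) • L (m + n) := lie_vec _ _
theorem lie_LH (n m : ℤ) : ⁅L n, H m⁆ = (m : ℂ) • H (m + n) := lie_vec _ _
theorem lie_LI (n m : ℤ) : ⁅L n, I m⁆ = ((m : ℂ) - n) • I (m + n) := lie_vec _ _
theorem lie_LJ (n m : ℤ) : ⁅L n, J m⁆ = ((m : ℂ) - n) • J (m + n) := lie_vec _ _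
theorem lie_HH (n m : ℤ) : ⁅H n, H m⁆ = 0 := lie_vec _ _
theorem lie_HI (n m : ℤ) : ⁅H n, I m⁆ = I (m + n) := lie_vec _ _
theorem lie_HJ (n m : ℤ) : ⁅H n, J m⁆ = -J (m + n) := lie_vec _ _
theorem lie_II (n m : ℤ) : ⁅I n, I m⁆ = 0 := lie_vec _ _
theorem lie_IJ (n m : ℤ) : ⁅I n, J m⁆ = 0 := lie_vec _ _
theorem lie_JJ (n m : ℤ) : ⁅J n, J m⁆ = 0 := lie_vec _ _

/-- The basis vectors `L m`, `H m`, `I m`, `J m` with `m ≥ 1`. -/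
def positiveVectors : Set PG :=
  {x | ∃ m : ℤ, 1 ≤ m ∧ (x = L m ∨ x = H m ∨ x = I m ∨ x = J m)}

theorem lie_mem_span_positive {x y : PG} (hx : x ∈ positiveVectors) (hy : y ∈ positiveVectors) :
    ⁅x, y⁆ ∈ Submodule.span ℂ positiveVectors := by
  obtain ⟨n, hn, hx⟩ := hx
  obtain ⟨m, hm, hy⟩ := hy
  have hk : 1 ≤ m + n := by omega
  have hk' : 1 ≤ n + m := by omega
  have hL : L (m + n) ∈ Submodule.span ℂ positiveVectors :=
    Submodule.subset_span ⟨_, hk, .inl rfl⟩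
  have hH : ∀ k : ℤ, 1 ≤ k → H k ∈ Submodule.span ℂ positiveVectors := fun k h =>
    Submodule.subset_span ⟨_, h, .inr (.inl rfl)⟩
  have hI : ∀ k : ℤ, 1 ≤ k → I k ∈ Submodule.span ℂ positiveVectors := fun k h =>
    Submodule.subset_span ⟨_, h, .inr (.inr (.inl rfl))⟩
  have hJ : ∀ k : ℤ, 1 ≤ k → J k ∈ Submodule.span ℂ positiveVectors := fun k h =>
    Submodule.subset_span ⟨_, h, .inr (.inr (.inr rfl))⟩
  rcases hx with rfl | rfl | rfl | rfl <;> rcases hy with rfl | rfl | rfl | rfl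
  · rw [lie_LL]; exact Submodule.smul_mem _ _ hL
  · rw [lie_LH]; exact Submodule.smul_mem _ _ (hH _ hk)
  · rw [lie_LI]; exact Submodule.smul_mem _ _ (hI _ hk)
  · rw [lie_LJ]; exact Submodule.smul_mem _ _ (hJ _ hk)
  · rw [← lie_skew, lie_LH]; exact Submodule.neg_mem _ (Submodule.smul_mem _ _ (hH _ hk'))
  · rw [lie_HH]; exact Submodule.zero_mem _
  · rw [lie_HI]; exact hI _ hk
  · rw [lie_HJ]; exact Submodule.neg_mem _ (hJ _ hk)
  · rw [← lie_skew, lie_LI]; exact Submodule.neg_mem _ (Submodule.smul_mem _ _ (hI _ hk'))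
  · rw [← lie_skew, lie_HI]; exact Submodule.neg_mem _ (hI _ hk')
  · rw [lie_II]; exact Submodule.zero_mem _
  · rw [lie_IJ]; exact Submodule.zero_mem _
  · rw [← lie_skew, lie_LJ]; exact Submodule.neg_mem _ (Submodule.smul_mem _ _ (hJ _ hk'))
  · rw [← lie_skew, lie_HJ]; exact Submodule.neg_mem _ (Submodule.neg_mem _ (hJ _ hk'))
  · rw [← lie_skew, lie_IJ, neg_zero]; exact Submodule.zero_mem _
  · rw [lie_JJ]; exact Submodule.zero_mem _

end PG

/-- The bracket of two vectors in the span of `s` is in that span if this holds for vectors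
of `s`. -/
theorem lie_mem_span_of_forall {g : Type} [LieRing g] [LieAlgebra ℂ g] {s : Set g}
    (hs : ∀ x ∈ s, ∀ y ∈ s, ⁅x, y⁆ ∈ Submodule.span ℂ s) {x y : g}
    (hx : x ∈ Submodule.span ℂ s) (hy : y ∈ Submodule.span ℂ s) :
    ⁅x, y⁆ ∈ Submodule.span ℂ s := by
  induction hx, hy using Submodule.span_induction₂ with
  | mem_mem x y hx hy => exact hs x hx y hy
  | zero_left y hy => simp
  | zero_right x hx => simp
  | add_left x y z _ _ _ h₁ h₂ => rw [add_lie]; exact Submodule.add_mem _ h₁ h₂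
  | add_right x y z _ _ _ h₁ h₂ => rw [lie_add]; exact Submodule.add_mem _ h₁ h₂
  | smul_left r x y _ _ h => rw [smul_lie]; exact Submodule.smul_mem _ _ h
  | smul_right r x y _ _ h => rw [lie_smul]; exact Submodule.smul_mem _ _ h

/-- The subalgebra of the planar Galilean conformal algebra spanned by
`L m`, `H m`, `I m`, `J m` with `m ≥ 1`. -/
def PGPos : LieSubalgebra ℂ PG where
  toSubmodule := Submodule.span ℂ PG.positiveVectors
  lie_mem' hx hy :=
    lie_mem_span_of_forall (fun _ h₁ _ h₂ => PG.lie_mem_span_positive h₁ h₂) hx hy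

/-! ## Its universal central extension -/

/-- Labels of the basis vectors `L m`, `H m`, `I m`, `J m` (`m ∈ ℤ`) and `C₁`, `C₂`, `C₃`
(written `C 0`, `C 1`, `C 2`). -/
inductive CPGIndex : Type
  | L (m : ℤ)
  | H (m : ℤ)
  | I (m : ℤ)
  | J (m : ℤ)
  | C (s : Fin 3)

/-- The complex vector space with basis `L m`, `H m`, `I m`, `J m`, `C s`. -/
def CPG : Type := CPGIndex →₀ ℂ

namespace CPG

instance : AddCommGroup CPG := inferInstanceAs (AddCommGroup (CPGIndex →₀ ℂ))

instance : Module ℂ CPG := inferInstanceAs (Module ℂ (CPGIndex →₀ ℂ))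

/-- The basis vectors. -/
def e (a : CPGIndex) : CPGIndex →₀ ℂ := Finsupp.single a 1

/-- Kronecker's `δ_{k,0}`. -/
def δ (k : ℤ) : ℂ := if k = 0 then 1 else 0

/-- The brackets of the basis vectors. -/
def br : CPGIndex → CPGIndex → (CPGIndex →₀ ℂ)
  | .L n, .L m => ((m : ℂ) - n) • e (.L (m + n)) + ((n : ℂ) ^ 3 * δ (m + n)) • e (.C 0)
  | .L n, .H m => (m : ℂ) • e (.H (m + n)) + ((n : ℂ) ^ 2 * δ (m + n)) • e (.C 1)
  | .L n, .I m => ((m : ℂ) - n) • e (.I (m + n))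
  | .L n, .J m => ((m : ℂ) - n) • e (.J (m + n))
  | .H n, .L m => -((n : ℂ) • e (.H (n + m)) + ((m : ℂ) ^ 2 * δ (n + m)) • e (.C 1))
  | .H n, .H m => ((n : ℂ) * δ (m + n)) • e (.C 2)
  | .H n, .I m => e (.I (m + n))
  | .H n, .J m => -e (.J (m + n))
  | .I n, .L m => -(((n : ℂ) - m) • e (.I (n + m)))
  | .I n, .H m => -e (.I (n + m))
  | .I _, .I _ => 0
  | .I _, .J _ => 0
  | .J n, .L m => -(((n : ℂ) - m) • e (.J (n + m)))
  | .J n, .H m => e (.J (n + m))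
  | .J _, .I _ => 0
  | .J _, .J _ => 0
  | .C _, _ => 0
  | _, .C _ => 0

theorem br_C_left (s : Fin 3) (a : CPGIndex) : br (.C s) a = 0 := by
  cases a <;> rfl

theorem br_C_right (s : Fin 3) (a : CPGIndex) : br a (.C s) = 0 := by
  cases a <;> rfl

theorem br_skew (a b : CPGIndex) : br a b = -br b a := by
  cases a <;> cases b <;> simp only [br, neg_neg, neg_zero]
  all_goals
    rename_i m n
    rw [add_comm m n]
    by_cases h : n + m = 0
    · obtain rfl : n = -m := by omega
      push_cast
      module
    · simp only [δ, if_neg h]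
      module

theorem br_jacobi (a b d : CPGIndex) :
    structureBracket br (Finsupp.single a 1) (br b d) =
      structureBracket br (br a b) (Finsupp.single d 1) +
        structureBracket br (Finsupp.single b 1) (br a d) := by
  cases a <;> cases b <;> cases d <;>
    simp only [br, e, map_add, map_smul, map_neg, map_zero, LinearMap.add_apply,
      LinearMap.smul_apply, LinearMap.neg_apply, LinearMap.zero_apply, structureBracket_single,
      smul_zero, add_zero, neg_zero] <;>
    (try simp only [add_comm, add_left_comm, Int.cast_add]) <;> try module
  all_goals
    rename_i n m k
    obtain ⟨t, ht⟩ : ∃ t, δ (n + (m + k)) = t := ⟨_, rfl⟩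
    simp only [ht]
    by_cases h : n + (m + k) = 0
    · have hk : (k : ℂ) = -n - m := by
        have : ((n + (m + k) : ℤ) : ℂ) = 0 := by rw [h]; simp
        push_cast at this
        linear_combination this
      simp only [hk]
      module
    · simp only [δ, if_neg h] at ht
      subst ht
      module

instance : LieRing CPG where
  bracket x y := structureBracket br x y
  add_lie x y z := LinearMap.map_add₂ (structureBracket br) x y z
  lie_add x y z := map_add (structureBracket br x) y z
  lie_self x := structureBracket_self br br_skew x
  leibniz_lie x y z := structureBracket_jacobi br br_jacobi x y z

instance : LieAlgebra ℂ CPG where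
  lie_smul t x y := map_smul (structureBracket br x) t y

/-- The basis vectors as elements of the Lie algebra. -/
def vec (a : CPGIndex) : CPG := e a

/-- The basis vector `L m`. -/
def L (m : ℤ) : CPG := vec (.L m)

/-- The basis vector `H m`. -/
def H (m : ℤ) : CPG := vec (.H m)

/-- The basis vector `I m`. -/
def I (m : ℤ) : CPG := vec (.I m)

/-- The basis vector `J m`. -/
def J (m : ℤ) : CPG := vec (.J m)

/-- The central elements `C₁ = C 0`, `C₂ = C 1`, `C₃ = C 2`. -/
def C (s : Fin 3) : CPG := vec (.C s)

theorem lie_vec (a b : CPGIndex) : ⁅vec a, vec b⁆ = (br a b : CPG) :=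
  structureBracket_single br a b

theorem lie_LL (n m : ℤ) :
    ⁅L n, L m⁆ = ((m : ℂ) - n) • L (m + n) + ((n : ℂ) ^ 3 * δ (m + n)) • C 0 := lie_vec _ _
theorem lie_LH (n m : ℤ) :
    ⁅L n, H m⁆ = (m : ℂ) • H (m + n) + ((n : ℂ) ^ 2 * δ (m + n)) • C 1 := lie_vec _ _
theorem lie_LI (n m : ℤ) : ⁅L n, I m⁆ = ((m : ℂ) - n) • I (m + n) := lie_vec _ _
theorem lie_LJ (n m : ℤ) : ⁅L n, J m⁆ = ((m : ℂ) - n) • J (m + n) := lie_vec _ _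
theorem lie_HH (n m : ℤ) : ⁅H n, H m⁆ = ((n : ℂ) * δ (m + n)) • C 2 := lie_vec _ _
theorem lie_HI (n m : ℤ) : ⁅H n, I m⁆ = I (m + n) := lie_vec _ _
theorem lie_HJ (n m : ℤ) : ⁅H n, J m⁆ = -J (m + n) := lie_vec _ _
theorem lie_II (n m : ℤ) : ⁅I n, I m⁆ = 0 := lie_vec _ _
theorem lie_IJ (n m : ℤ) : ⁅I n, J m⁆ = 0 := lie_vec _ _
theorem lie_JJ (n m : ℤ) : ⁅J n, J m⁆ = 0 := lie_vec _ _

theorem lie_C (x : CPG) (s : Fin 3) : ⁅x, C s⁆ = 0 := by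
  suffices h : (structureBracket br).flip (Finsupp.single (.C s) 1) = 0 from
    LinearMap.congr_fun h x
  refine Finsupp.lhom_ext' fun a => LinearMap.ext_ring ?_
  simp only [LinearMap.comp_apply, Finsupp.lsingle_apply, LinearMap.flip_apply,
    LinearMap.zero_apply, structureBracket_single]
  exact br_C_right s a

/-- The basis vectors `L m`, `H m`, `I m`, `J m` with `m ≥ 1`. -/
def positiveVectors : Set CPG :=
  {x | ∃ m : ℤ, 1 ≤ m ∧ (x = L m ∨ x = H m ∨ x = I m ∨ x = J m)}

theorem lie_mem_span_positive {x y : CPG} (hx : x ∈ positiveVectors) (hy : y ∈ positiveVectors) :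
    ⁅x, y⁆ ∈ Submodule.span ℂ positiveVectors := by
  obtain ⟨n, hn, hx⟩ := hx
  obtain ⟨m, hm, hy⟩ := hy
  have hk : 1 ≤ m + n := by omega
  have hk' : 1 ≤ n + m := by omega
  have hd : δ (m + n) = 0 := if_neg (by omega)
  have hd' : δ (n + m) = 0 := if_neg (by omega)
  have hL : L (m + n) ∈ Submodule.span ℂ positiveVectors :=
    Submodule.subset_span ⟨_, hk, .inl rfl⟩
  have hH : ∀ k : ℤ, 1 ≤ k → H k ∈ Submodule.span ℂ positiveVectors := fun k h =>
    Submodule.subset_span ⟨_, h, .inr (.inl rfl)⟩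
  have hI : ∀ k : ℤ, 1 ≤ k → I k ∈ Submodule.span ℂ positiveVectors := fun k h =>
    Submodule.subset_span ⟨_, h, .inr (.inr (.inl rfl))⟩
  have hJ : ∀ k : ℤ, 1 ≤ k → J k ∈ Submodule.span ℂ positiveVectors := fun k h =>
    Submodule.subset_span ⟨_, h, .inr (.inr (.inr rfl))⟩
  rcases hx with rfl | rfl | rfl | rfl <;> rcases hy with rfl | rfl | rfl | rfl
  · rw [lie_LL, hd, mul_zero, zero_smul, add_zero]; exact Submodule.smul_mem _ _ hL
  · rw [lie_LH, hd, mul_zero, zero_smul, add_zero]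
   ; exact Submodule.smul_mem _ _ (hH _ hk)
  · rw [lie_LI]; exact Submodule.smul_mem _ _ (hI _ hk)
  · rw [lie_LJ]; exact Submodule.smul_mem _ _ (hJ _ hk)
  · rw [← lie_skew, lie_LH, hd', mul_zero, zero_smul, add_zero]
   ; exact Submodule.neg_mem _ (Submodule.smul_mem _ _ (hH _ hk'))
  · rw [lie_HH, hd, mul_zero, zero_smul]; exact Submodule.zero_mem _
  · rw [lie_HI]; exact hI _ hk
  · rw [lie_HJ]; exact Submodule.neg_mem _ (hJ _ hk)
  · rw [← lie_skew, lie_LI]; exact Submodule.neg_mem _ (Submodule.smul_mem _ _ (hI _ hk'))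
  · rw [← lie_skew, lie_HI]; exact Submodule.neg_mem _ (hI _ hk')
  · rw [lie_II]; exact Submodule.zero_mem _
  · rw [lie_IJ]; exact Submodule.zero_mem _
  · rw [← lie_skew, lie_LJ]; exact Submodule.neg_mem _ (Submodule.smul_mem _ _ (hJ _ hk'))
  · rw [← lie_skew, lie_HJ]; exact Submodule.neg_mem _ (Submodule.neg_mem _ (hJ _ hk'))
  · rw [← lie_skew, lie_IJ, neg_zero]; exact Submodule.zero_mem _
  · rw [lie_JJ]; exact Submodule.zero_mem _

end CPG

/-- The subalgebra of the central extension spanned by `L m`, `H m`, `I m`, `J m` with `m ≥ 1`. -/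
def CPGPos : LieSubalgebra ℂ CPG where
  toSubmodule := Submodule.span ℂ CPG.positiveVectors
  lie_mem' hx hy :=
    lie_mem_span_of_forall (fun _ h₁ _ h₂ => CPG.lie_mem_span_positive h₁ h₂) hx hy

/-! ## Induced modules -/

section Induced

attribute [local instance 100] LieRing.ofAssociativeRing
attribute [local instance] LieRingModule.ofAssociativeModule

variable {g : Type} [LieRing g] [LieAlgebra ℂ g] {p : LieSubalgebra ℂ g}

/-- The one-dimensional module `ℂ_φ = ℂ w_φ`. -/
def OneDim (_φ : LieAlgebra.LieCharacter ℂ p) : Type := ℂ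

namespace OneDim

variable (φ : LieAlgebra.LieCharacter ℂ p)

instance : AddCommGroup (OneDim φ) := inferInstanceAs (AddCommGroup ℂ)

instance : Module ℂ (OneDim φ) := inferInstanceAs (Module ℂ ℂ)

/-- The underlying vector space of `ℂ_φ` is `ℂ`. -/
def toComplex : OneDim φ ≃ₗ[ℂ] ℂ := LinearEquiv.refl ℂ ℂ

/-- The basis vector `w_φ`. -/
def w : OneDim φ := (toComplex φ).symm 1

/-- The universal enveloping algebra of `p` acts on `ℂ_φ` through the algebra homomorphism to `ℂ`
that extends `φ`. -/
instance : Module (UniversalEnvelopingAlgebra ℂ p) (OneDim φ) :=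
  Module.compHom ℂ (UniversalEnvelopingAlgebra.lift ℂ φ).toRingHom

theorem toComplex_smul (a : UniversalEnvelopingAlgebra ℂ p) (v : OneDim φ) :
    toComplex φ (a • v) = UniversalEnvelopingAlgebra.lift ℂ φ a * toComplex φ v := rfl

theorem ι_smul (x : p) (v : OneDim φ) :
    UniversalEnvelopingAlgebra.ι ℂ x • v = φ x • v :=
  congrArg (fun c : ℂ => c • v) (UniversalEnvelopingAlgebra.lift_ι_apply ℂ φ x)

end OneDim

/-- The homomorphism `U(p) → U(g)` induced by the inclusion of `p` in `g`. -/
def envelopingMap (p : LieSubalgebra ℂ g) :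
    UniversalEnvelopingAlgebra ℂ p →ₐ[ℂ] UniversalEnvelopingAlgebra ℂ g :=
  UniversalEnvelopingAlgebra.lift ℂ ((UniversalEnvelopingAlgebra.ι ℂ).comp p.incl)

/-- The `U(g)`-submodule of `U(g) ⊗ ℂ_φ` (tensor product over `ℂ`) generated by the elements
`u a ⊗ w - u ⊗ a w` with `a ∈ U(p)`. -/
def balancingSubmodule (φ : LieAlgebra.LieCharacter ℂ p) :
    Submodule (UniversalEnvelopingAlgebra ℂ g) (UniversalEnvelopingAlgebra ℂ g ⊗[ℂ] OneDim φ) :=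
  Submodule.span _ {t | ∃ (u : UniversalEnvelopingAlgebra ℂ g)
    (a : UniversalEnvelopingAlgebra ℂ p) (w : OneDim φ),
      t = (u * envelopingMap p a) ⊗ₜ[ℂ] w - u ⊗ₜ[ℂ] (a • w)}

/-- The induced module: the tensor product of `U(g)` and `ℂ_φ` over the (noncommutative) ring
`U(p)`, as the quotient of their tensor product over `ℂ` by the balancing relations. -/
def InducedModule (φ : LieAlgebra.LieCharacter ℂ p) : Type :=
  (UniversalEnvelopingAlgebra ℂ g ⊗[ℂ] OneDim φ) ⧸ balancingSubmodule φ

namespace InducedModule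

variable (φ : LieAlgebra.LieCharacter ℂ p)

instance : AddCommGroup (InducedModule φ) :=
  inferInstanceAs (AddCommGroup (_ ⧸ balancingSubmodule φ))

instance : Module (UniversalEnvelopingAlgebra ℂ g) (InducedModule φ) :=
  inferInstanceAs (Module _ (_ ⧸ balancingSubmodule φ))

instance : Module ℂ (InducedModule φ) :=
  inferInstanceAs (Module ℂ (_ ⧸ balancingSubmodule φ))

instance : IsScalarTower ℂ (UniversalEnvelopingAlgebra ℂ g) (InducedModule φ) :=
  inferInstanceAs (IsScalarTower ℂ (UniversalEnvelopingAlgebra ℂ g) (_ ⧸ balancingSubmodule φ))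

/-- `g` acts on the induced module through its map to `U(g)`. -/
instance : LieRingModule g (InducedModule φ) :=
  LieRingModule.compLieHom (InducedModule φ) (UniversalEnvelopingAlgebra.ι ℂ (L := g))

theorem lie_def (x : g) (v : InducedModule φ) :
    ⁅x, v⁆ = UniversalEnvelopingAlgebra.ι ℂ x • v := rfl

instance : LieModule ℂ g (InducedModule φ) :=
  haveI : LieModule ℂ (UniversalEnvelopingAlgebra ℂ g) (InducedModule φ) :=
    LieModule.ofAssociativeModule
  LieModule.compLieHom (InducedModule φ) (UniversalEnvelopingAlgebra.ι ℂ (L := g))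

/-- The generator `1 ⊗ w_φ`. -/
def w : InducedModule φ :=
  (balancingSubmodule φ).mkQ (1 ⊗ₜ[ℂ] OneDim.w φ)

end InducedModule

end Induced

/-! ## Whittaker modules -/

/-- The universal Whittaker module `M(φ)` of the planar Galilean conformal algebra. -/
abbrev WhittakerM (φ : LieAlgebra.LieCharacter ℂ PGPos) : Type := InducedModule φ

/-- The universal Whittaker module `M̃(φ)` of the central extension. -/
abbrev WhittakerMTilde (φ : LieAlgebra.LieCharacter ℂ CPGPos) : Type := InducedModule φ

/-- The submodule `∑ s, (C s - ξ s) M̃(φ)` of `M̃(φ)`. -/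
def centralSubmodule (φ : LieAlgebra.LieCharacter ℂ CPGPos) (ξ : Fin 3 → ℂ) :
    LieSubmodule ℂ CPG (WhittakerMTilde φ) where
  toSubmodule := ⨆ s : Fin 3,
    LinearMap.range (LieModule.toEnd ℂ CPG (WhittakerMTilde φ) (CPG.C s) - ξ s • LinearMap.id)
  lie_mem := by
    intro x m hm
    change m ∈ (⨆ s : Fin 3, LinearMap.range
      (LieModule.toEnd ℂ CPG (WhittakerMTilde φ) (CPG.C s) - ξ s • LinearMap.id)) at hm
    change ⁅x, m⁆ ∈ (⨆ s : Fin 3, LinearMap.range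
      (LieModule.toEnd ℂ CPG (WhittakerMTilde φ) (CPG.C s) - ξ s • LinearMap.id))
    induction hm using Submodule.iSup_induction' with
    | mem s y hy =>
      obtain ⟨v, rfl⟩ := hy
      refine Submodule.mem_iSup_of_mem s ⟨⁅x, v⁆, ?_⟩
      simp only [LinearMap.sub_apply, LieModule.toEnd_apply_apply, LinearMap.smul_apply,
        LinearMap.id_apply, lie_sub, lie_smul]
      rw [leibniz_lie x, CPG.lie_C, zero_lie, zero_add]
    | zero => simp
    | add y z _ _ hy hz => rw [lie_add]; exact Submodule.add_mem _ hy hz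

/-- The generic Whittaker module `L̃_{φ,ξ}` of the central extension. -/
abbrev WhittakerLTilde (φ : LieAlgebra.LieCharacter ℂ CPGPos) (ξ : Fin 3 → ℂ) : Type :=
  WhittakerMTilde φ ⧸ centralSubmodule φ ξ

end

noncomputable section

/-! ### Subspaces stable under an enveloping algebra. -/

section General

attribute [local instance 100] LieRing.ofAssociativeRing
attribute [local instance] LieRingModule.ofAssociativeModule

variable {g : Type} [LieRing g] [LieAlgebra ℂ g]

/-! An isomorphism carries the generator of its source to a nonzero eigenvector of the positive part
`p` in its target, with the character of the source. So it suffices that in a module generated by an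
eigenvector with character `φ`, every nonzero eigenvector of `p` has character `φ`
(`character_eq_of_eigenvector`). By the grading, repeated brackets with elements of `p` bring each
element of `g` into `p`. Hence every vector of the module is killed by all sufficiently long
products of operators `x - φ x` with `x` in `p`. On an eigenvector with character `φ'` such an
operator is the scalar `φ' x - φ x`, which must vanish.

This needs the generator to be nonzero, which usually follows from the Poincaré-Birkhoff-Witt
theorem. Here that theorem is replaced by an explicit action of `g` on `U(q)`, where `q` is a
subalgebra complementary to `p` (`exists_realization`): it gives a `q`-equivariant map from the
induced module to `U(q)` that takes the generator to `1`. Here `q` is the span of the basis vectors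
of degree at most `0`.

For the quotients by the central relations, that map is composed with a character of `q` taking the
value `ξ s` at `C s`. It kills every `(C s - ξ s) v` but not the generator
(`w_notMem_centralSubmodule`). The parameter `ξ` is then read off from the scalars by which the
central elements act. -/

/-- A subspace of a `U(g)`-module that is stable under `g` is stable under `U(g)`. -/
theorem UniversalEnvelopingAlgebra.smul_mem_of_forall_ι {V : Type} [AddCommGroup V] [Module ℂ V]
    [Module (UniversalEnvelopingAlgebra ℂ g) V]
    [IsScalarTower ℂ (UniversalEnvelopingAlgebra ℂ g) V] (N : Submodule ℂ V)
    (hN : ∀ (x : g), ∀ v ∈ N, UniversalEnvelopingAlgebra.ι ℂ x • v ∈ N)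
    (a : UniversalEnvelopingAlgebra ℂ g) {v : V} (hv : v ∈ N) : a • v ∈ N := by
  let S : Subalgebra ℂ (UniversalEnvelopingAlgebra ℂ g) :=
    { carrier := {a | ∀ v ∈ N, a • v ∈ N}
      mul_mem' := fun {a b} ha hb v hv => by rw [mul_smul]; exact ha _ (hb _ hv)
      add_mem' := fun {a b} ha hb v hv => by rw [add_smul]; exact N.add_mem (ha _ hv) (hb _ hv)
      algebraMap_mem' := fun r v hv => by rw [algebraMap_smul]; exact N.smul_mem _ hv }
  let j : g →ₗ⁅ℂ⁆ S :=
    { toFun := fun x => ⟨UniversalEnvelopingAlgebra.ι ℂ x, hN x⟩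
      map_add' := fun x y => Subtype.ext (map_add (UniversalEnvelopingAlgebra.ι ℂ) x y)
      map_smul' := fun r x => Subtype.ext (map_smul (UniversalEnvelopingAlgebra.ι ℂ) r x)
      map_lie' := fun {x y} =>
        Subtype.ext (LieHom.map_lie (UniversalEnvelopingAlgebra.ι ℂ) x y) }
  -- The universal property yields a right inverse of the inclusion of `S`, so the stabilizer `S` of
  -- `N` is all of `U(g)`.
  have h : S.val.comp (UniversalEnvelopingAlgebra.lift ℂ j) = AlgHom.id ℂ _ := by
    refine UniversalEnvelopingAlgebra.hom_ext ℂ (LieHom.ext fun x => ?_)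
    exact congrArg Subtype.val (UniversalEnvelopingAlgebra.lift_ι_apply ℂ j x)
  have ha : ((UniversalEnvelopingAlgebra.lift ℂ j a : S) : UniversalEnvelopingAlgebra ℂ g) = a :=
    DFunLike.congr_fun h a
  rw [← ha]
  exact (UniversalEnvelopingAlgebra.lift ℂ j a).2 v hv

/-- A subspace of `U(g)` that contains `1` and is stable under left multiplication by `g` is
everything. -/
theorem UniversalEnvelopingAlgebra.mem_of_one_mem (N : Submodule ℂ (UniversalEnvelopingAlgebra ℂ g))
    (h1 : 1 ∈ N) (hN : ∀ (x : g), ∀ v ∈ N, UniversalEnvelopingAlgebra.ι ℂ x * v ∈ N)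
    (a : UniversalEnvelopingAlgebra ℂ g) : a ∈ N := by
  simpa using smul_mem_of_forall_ι N hN a h1

/-! ### The induced module realized on the enveloping algebra of a complement -/

section Realization

variable {p q : LieSubalgebra ℂ g}

/-- The action of `q` on the linear maps from `g` to `U(q)`. -/
def homAction (q : LieSubalgebra ℂ g) :
    q →ₗ⁅ℂ⁆ Module.End ℂ (g →ₗ[ℂ] UniversalEnvelopingAlgebra ℂ q) where
  -- The usual action on a space of linear maps: left multiplication on the values, the adjoint
  -- action on the arguments.
  toFun y :=
    { toFun := fun f => LinearMap.mulLeft ℂ (UniversalEnvelopingAlgebra.ι ℂ y) ∘ₗ f -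
        f ∘ₗ LieAlgebra.ad ℂ g y
      map_add' := fun f f' => by
        ext x
        simp only [LinearMap.sub_apply, LinearMap.comp_apply, LinearMap.add_apply,
          map_add]
        abel
      map_smul' := fun r f => by
        ext x
        simp [smul_sub] }
  map_add' y z := by
    ext f x
    simp [add_mul]
    abel
  map_smul' r y := by
    ext f x
    simp [smul_sub]
  map_lie' {y z} := by
    ext f x
    simp [LieRing.of_associative_ring_bracket, sub_mul, mul_sub, mul_assoc]
    abel

theorem homAction_apply (y : q) (f : g →ₗ[ℂ] UniversalEnvelopingAlgebra ℂ q) (x : g) :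
    homAction q y f x = UniversalEnvelopingAlgebra.ι ℂ y * f x - f ⁅(y : g), x⁆ := rfl

variable (h : IsCompl q.toSubmodule p.toSubmodule) (φ : LieAlgebra.LieCharacter ℂ p)

/-- The action of `g` on the generator `1` of `U(q)`. -/
def actionOnOne : g →ₗ[ℂ] UniversalEnvelopingAlgebra ℂ q :=
  LinearMap.ofIsCompl h (UniversalEnvelopingAlgebra.ι ℂ (L := q)).toLinearMap
    (Algebra.linearMap ℂ _ ∘ₗ φ.toLinearMap)

theorem actionOnOne_left (y : q) :
    actionOnOne h φ y = UniversalEnvelopingAlgebra.ι ℂ y :=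
  LinearMap.ofIsCompl_apply_left h y

theorem actionOnOne_right (x : p) :
    actionOnOne h φ x = algebraMap ℂ _ (φ x) :=
  LinearMap.ofIsCompl_apply_right h x

/-- The action of `g` on `U(q)`. -/
def realization : g →ₗ[ℂ] Module.End ℂ (UniversalEnvelopingAlgebra ℂ q) :=
  -- With `α = actionOnOne h φ`, an element `u` of `U(q)` acts on `α` through `homAction`, and `x`
  -- sends `u` to the value of `u • α` at `x`. The universal property of `U(q)` makes this well
  -- defined without a basis of `U(q)`.
  LinearMap.flip ((LinearMap.applyₗ (actionOnOne h φ)) ∘ₗ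
    (UniversalEnvelopingAlgebra.lift ℂ (homAction q)).toLinearMap)

theorem realization_one (x : g) : realization h φ x 1 = actionOnOne h φ x := by
  change UniversalEnvelopingAlgebra.lift ℂ (homAction q) 1 (actionOnOne h φ) x = _
  rw [map_one, Module.End.one_apply]

/-- This is the rule `x y u = y x u + [x, y] u` that any extension of left multiplication to an
action of `g` must satisfy; `homAction` was chosen to enforce it. Together with the values at `1` it
determines the action. -/
theorem realization_ι_mul (x : g) (y : q) (u : UniversalEnvelopingAlgebra ℂ q) :
    realization h φ x (UniversalEnvelopingAlgebra.ι ℂ y * u) =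
      UniversalEnvelopingAlgebra.ι ℂ y * realization h φ x u + realization h φ ⁅x, (y : g)⁆ u := by
  change UniversalEnvelopingAlgebra.lift ℂ (homAction q) (_ * u) (actionOnOne h φ) x = _
  rw [map_mul, Module.End.mul_apply, UniversalEnvelopingAlgebra.lift_ι_apply, homAction_apply,
    ← lie_skew x, map_neg, LinearMap.neg_apply, sub_eq_add_neg]
  rfl

theorem realization_left (y : q) (u : UniversalEnvelopingAlgebra ℂ q) :
    realization h φ y u = UniversalEnvelopingAlgebra.ι ℂ y * u := by
  revert y
  -- The claim is proved for all `y` at once, because passing from `v` to `z v` uses it at `v` for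
  -- both `y` and `⁅y, z⁆`.
  suffices hu : u ∈ (⨅ y : q, LinearMap.eqLocus (realization h φ y)
      (LinearMap.mulLeft ℂ (UniversalEnvelopingAlgebra.ι ℂ y))) by
    simp only [Submodule.mem_iInf] at hu
    exact hu
  refine UniversalEnvelopingAlgebra.mem_of_one_mem _ ?_ (fun z v hv => ?_) u
  · simp only [Submodule.mem_iInf]
    intro y
    change realization h φ y 1 = _ * 1
    rw [realization_one, actionOnOne_left, mul_one]
  · simp only [Submodule.mem_iInf] at hv ⊢
    intro y
    have hy : realization h φ y v = UniversalEnvelopingAlgebra.ι ℂ y * v := hv y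
    have hyz : realization h φ ⁅(y : g), (z : g)⁆ v = UniversalEnvelopingAlgebra.ι ℂ ⁅y, z⁆ * v :=
      hv ⁅y, z⁆
    change realization h φ y _ = UniversalEnvelopingAlgebra.ι ℂ y * _
    rw [realization_ι_mul, hy, hyz, LieHom.map_lie, LieRing.of_associative_ring_bracket]
    noncomm_ring

/-! ### The action on `U(q)` respects brackets. -/

/-- The defect of `realization` to be a homomorphism of Lie algebras. -/
def realizationDefect (x z : g) : Module.End ℂ (UniversalEnvelopingAlgebra ℂ q) :=
  realization h φ ⁅x, z⁆ - ⁅realization h φ x, realization h φ z⁆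

theorem realizationDefect_apply (x z : g) (u : UniversalEnvelopingAlgebra ℂ q) :
    realizationDefect h φ x z u = realization h φ ⁅x, z⁆ u -
      (realization h φ x (realization h φ z u) - realization h φ z (realization h φ x u)) := rfl

/-- By the Jacobi identity, the value of a defect at `y u` is expressed through values of defects at
`u`. Hence the vectors killed by all defects form a left ideal of `U(q)`, and only the vector `1`
remains to be checked. -/
theorem realizationDefect_ι_mul (x z : g) (y : q) (u : UniversalEnvelopingAlgebra ℂ q) :
    realizationDefect h φ x z (UniversalEnvelopingAlgebra.ι ℂ y * u) =
      UniversalEnvelopingAlgebra.ι ℂ y * realizationDefect h φ x z u +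
        realizationDefect h φ ⁅x, (y : g)⁆ z u + realizationDefect h φ x ⁅z, (y : g)⁆ u := by
  have e : ⁅⁅x, z⁆, (y : g)⁆ = ⁅⁅x, (y : g)⁆, z⁆ + ⁅x, ⁅z, (y : g)⁆⁆ := by
    rw [lie_lie x z (y : g), ← lie_skew ⁅x, (y : g)⁆ z]
    abel
  simp only [realizationDefect_apply, realization_ι_mul, map_add, e, LinearMap.add_apply, mul_sub]
  abel

/-- Since `y` acts by left multiplication, this is exactly the commutation rule `realization_ι_mul`.
-/
theorem realizationDefect_eq_zero_left (x : g) (y : q) : realizationDefect h φ x y = 0 := by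
  ext u
  rw [realizationDefect_apply, realization_left, realization_left, realization_ι_mul]
  simp

theorem realizationDefect_skew (x z : g) :
    realizationDefect h φ x z = -realizationDefect h φ z x := by
  rw [realizationDefect, realizationDefect, ← lie_skew x z, map_neg,
    ← lie_skew (realization h φ x)]
  abel

theorem realizationDefect_add_right (x z z' : g) :
    realizationDefect h φ x (z + z') = realizationDefect h φ x z + realizationDefect h φ x z' := by
  simp only [realizationDefect, lie_add, map_add]
  abel

/-- Elements of `p` act on `1` by scalars, which commute, and a character vanishes on brackets. -/
theorem realizationDefect_one_eq_zero (x z : p) : realizationDefect h φ x z 1 = 0 := by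
  have h1 (x : p) : realization h φ x 1 = φ x • 1 := by
    rw [realization_one, actionOnOne_right, Algebra.algebraMap_eq_smul_one]
  have h2 : realization h φ ⁅(x : g), (z : g)⁆ 1 = φ ⁅x, z⁆ • 1 := h1 ⁅x, z⁆
  rw [realizationDefect_apply, h2, h1, h1, map_smul, map_smul, h1, h1,
    LieAlgebra.lieCharacter_apply_lie, smul_smul, smul_smul, mul_comm]
  simp

theorem realizationDefect_eq_zero (x z : g) : realizationDefect h φ x z = 0 := by
  have hdec (x : g) : ∃ (y : q) (x' : p), x = y + x' := by
    obtain ⟨y, hy, x', hx', rfl⟩ := Submodule.mem_sup.mp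
      (h.sup_eq_top ▸ Submodule.mem_top : x ∈ q.toSubmodule ⊔ p.toSubmodule)
    exact ⟨⟨y, hy⟩, ⟨x', hx'⟩, rfl⟩
  ext u
  revert x z
  suffices hu : u ∈ (⨅ x : g, ⨅ z : g, LinearMap.ker (realizationDefect h φ x z)) by
    simp only [Submodule.mem_iInf] at hu
    exact hu
  refine UniversalEnvelopingAlgebra.mem_of_one_mem _ ?_ (fun y v hv => ?_) u
  · simp only [Submodule.mem_iInf, LinearMap.mem_ker]
    intro x z
    -- Components in `q` contribute nothing, in either argument by skew-symmetry, so at the vector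
    -- `1` both arguments may be taken in `p`.
    obtain ⟨y, z, rfl⟩ := hdec z
    obtain ⟨y', x, rfl⟩ := hdec x
    rw [realizationDefect_add_right, realizationDefect_eq_zero_left, zero_add,
      realizationDefect_skew, realizationDefect_add_right, realizationDefect_eq_zero_left,
      zero_add, LinearMap.neg_apply, realizationDefect_one_eq_zero, neg_zero]
  · simp only [Submodule.mem_iInf, LinearMap.mem_ker] at hv ⊢
    intro x z
    simp only [realizationDefect_ι_mul, hv, mul_zero, add_zero]

/-! ### The map from the induced module to `U(q)`. -/

/-- The action of `g` on `U(q)` as a homomorphism of Lie algebras. -/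
def realizationHom : g →ₗ⁅ℂ⁆ Module.End ℂ (UniversalEnvelopingAlgebra ℂ q) :=
  { realization h φ with
    map_lie' := fun {x z} => sub_eq_zero.mp (realizationDefect_eq_zero h φ x z) }

/-- This makes the orbit map `u ↦ u • 1` compatible with the balancing relations, so that it
descends to the induced module. -/
theorem lift_realizationHom_envelopingMap_one (a : UniversalEnvelopingAlgebra ℂ p) :
    UniversalEnvelopingAlgebra.lift ℂ (realizationHom h φ) (envelopingMap p a) 1 =
      UniversalEnvelopingAlgebra.lift ℂ φ a • 1 := by
  suffices ha : a ∈ LinearMap.eqLocus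
      (LinearMap.applyₗ (R := ℂ) (1 : UniversalEnvelopingAlgebra ℂ q) ∘ₗ
        (UniversalEnvelopingAlgebra.lift ℂ (realizationHom h φ)).toLinearMap ∘ₗ
          (envelopingMap p).toLinearMap)
      ((UniversalEnvelopingAlgebra.lift ℂ φ).toLinearMap.smulRight 1) from ha
  refine UniversalEnvelopingAlgebra.mem_of_one_mem _ ?_ (fun x v hv => ?_) a
  · change UniversalEnvelopingAlgebra.lift ℂ (realizationHom h φ) (envelopingMap p 1) 1 =
      UniversalEnvelopingAlgebra.lift ℂ φ 1 • 1
    simp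
  · replace hv : UniversalEnvelopingAlgebra.lift ℂ (realizationHom h φ) (envelopingMap p v) 1 =
      UniversalEnvelopingAlgebra.lift ℂ φ v • 1 := hv
    change UniversalEnvelopingAlgebra.lift ℂ (realizationHom h φ) (envelopingMap p (_ * v)) 1 =
      UniversalEnvelopingAlgebra.lift ℂ φ (_ * v) • 1
    have hx : realizationHom h φ (x : g) 1 = φ x • 1 := by
      rw [← Algebra.algebraMap_eq_smul_one, ← actionOnOne_right h φ, ← realization_one]
      rfl
    have hι : envelopingMap p (UniversalEnvelopingAlgebra.ι ℂ x) =
        UniversalEnvelopingAlgebra.ι ℂ (x : g) :=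
      UniversalEnvelopingAlgebra.lift_ι_apply ℂ _ x
    rw [map_mul, map_mul, Module.End.mul_apply, hv, map_smul, hι,
      UniversalEnvelopingAlgebra.lift_ι_apply, hx, map_mul,
      UniversalEnvelopingAlgebra.lift_ι_apply, smul_smul, mul_comm]

/-- If `q` is a complement of `p`, there is a `q`-equivariant map from the induced module to `U(q)`
that sends the generator to `1`. -/
theorem exists_realization (h : IsCompl q.toSubmodule p.toSubmodule)
    (φ : LieAlgebra.LieCharacter ℂ p) :
    ∃ Ψ : InducedModule φ →ₗ[ℂ] UniversalEnvelopingAlgebra ℂ q,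
      Ψ (InducedModule.w φ) = 1 ∧
      ∀ (y : q) (v : InducedModule φ), Ψ ⁅(y : g), v⁆ = UniversalEnvelopingAlgebra.ι ℂ y * Ψ v := by
  let : Module (UniversalEnvelopingAlgebra ℂ g) (UniversalEnvelopingAlgebra ℂ q) :=
    Module.compHom _ (UniversalEnvelopingAlgebra.lift ℂ (realizationHom h φ)).toRingHom
  have hsmul (u : UniversalEnvelopingAlgebra ℂ g) (v : UniversalEnvelopingAlgebra ℂ q) :
      u • v = UniversalEnvelopingAlgebra.lift ℂ (realizationHom h φ) u v := rfl
  have : IsScalarTower ℂ (UniversalEnvelopingAlgebra ℂ g) (UniversalEnvelopingAlgebra ℂ q) :=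
    ⟨fun r u v => by rw [hsmul, hsmul, map_smul, LinearMap.smul_apply]⟩
  let θ₀ : UniversalEnvelopingAlgebra ℂ g ⊗[ℂ] OneDim φ →ₗ[ℂ] UniversalEnvelopingAlgebra ℂ q :=
    TensorProduct.lift (LinearMap.flip ((LinearMap.toSpanSingleton ℂ _
      (LinearMap.applyₗ (R := ℂ) (1 : UniversalEnvelopingAlgebra ℂ q) ∘ₗ
        (UniversalEnvelopingAlgebra.lift ℂ (realizationHom h φ)).toLinearMap)) ∘ₗ
          (OneDim.toComplex φ).toLinearMap))
  have hθ₀ (u : UniversalEnvelopingAlgebra ℂ g) (c : OneDim φ) :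
      θ₀ (u ⊗ₜ c) = OneDim.toComplex φ c •
        UniversalEnvelopingAlgebra.lift ℂ (realizationHom h φ) u 1 := rfl
  let θ : UniversalEnvelopingAlgebra ℂ g ⊗[ℂ] OneDim φ →ₗ[UniversalEnvelopingAlgebra ℂ g]
      UniversalEnvelopingAlgebra ℂ q :=
    { θ₀ with
      map_smul' := fun u t => by
        change θ₀ (u • t) = u • θ₀ t
        induction t with
        | zero => simp
        | add s t hs ht => rw [smul_add, map_add, hs, ht, map_add, smul_add]
        | tmul a c =>
          rw [TensorProduct.smul_tmul', hθ₀, hθ₀, hsmul, smul_eq_mul, map_mul,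
            Module.End.mul_apply, LinearMap.map_smul] }
  have hθ : balancingSubmodule φ ≤ LinearMap.ker θ := by
    refine Submodule.span_le.mpr ?_
    rintro _ ⟨u, a, c, rfl⟩
    change θ₀ _ = 0
    rw [map_sub, hθ₀, hθ₀, map_mul, Module.End.mul_apply, lift_realizationHom_envelopingMap_one,
      OneDim.toComplex_smul, map_smul, smul_smul, mul_comm, sub_self]
  let Ψ : InducedModule φ →ₗ[UniversalEnvelopingAlgebra ℂ g] UniversalEnvelopingAlgebra ℂ q :=
    (balancingSubmodule φ).liftQ θ hθ
  refine ⟨Ψ.restrictScalars ℂ, ?_, fun y v => ?_⟩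
  · change θ₀ (1 ⊗ₜ OneDim.w φ) = 1
    rw [hθ₀, map_one (UniversalEnvelopingAlgebra.lift ℂ (realizationHom h φ)),
      Module.End.one_apply, OneDim.w, LinearEquiv.apply_symm_apply, one_smul]
  · change Ψ (UniversalEnvelopingAlgebra.ι ℂ (y : g) • v) = _
    rw [map_smul, hsmul, UniversalEnvelopingAlgebra.lift_ι_apply]
    exact realization_left h φ y _

end Realization

/-! ### The generator of an induced module -/

namespace InducedModule

variable {p : LieSubalgebra ℂ g} (φ : LieAlgebra.LieCharacter ℂ p)

theorem mk_tmul (u : UniversalEnvelopingAlgebra ℂ g) (c : OneDim φ) :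
    (balancingSubmodule φ).mkQ (u ⊗ₜ[ℂ] c) = OneDim.toComplex φ c • u • (w φ) := by
  have hc : c = OneDim.toComplex φ c • OneDim.w φ := by
    apply (OneDim.toComplex φ).injective
    simp [OneDim.w]
  have hu : u ⊗ₜ[ℂ] c = OneDim.toComplex φ c • u • ((1 : UniversalEnvelopingAlgebra ℂ g) ⊗ₜ[ℂ]
      OneDim.w φ) := by
    rw [TensorProduct.smul_tmul', smul_eq_mul, mul_one, ← TensorProduct.tmul_smul, ← hc]
  rw [hu]
  rfl

/-- The generator is an eigenvector of `p`. -/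
theorem lie_w (x : p) : ⁅(x : g), w φ⁆ = φ x • w φ := by
  have h := (Submodule.Quotient.mk_eq_zero (balancingSubmodule φ)).mpr
    (Submodule.subset_span ⟨1, UniversalEnvelopingAlgebra.ι ℂ x, OneDim.w φ, rfl⟩)
  have hι : envelopingMap p (UniversalEnvelopingAlgebra.ι ℂ x) =
      UniversalEnvelopingAlgebra.ι ℂ (x : g) :=
    UniversalEnvelopingAlgebra.lift_ι_apply ℂ _ x
  rw [one_mul, Submodule.Quotient.mk_sub, sub_eq_zero, hι, OneDim.ι_smul] at h
  have h1 := mk_tmul φ (UniversalEnvelopingAlgebra.ι ℂ (x : g)) (OneDim.w φ)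
  have h2 := mk_tmul φ 1 (φ x • OneDim.w φ)
  have hw : OneDim.toComplex φ (OneDim.w φ) = 1 := LinearEquiv.apply_symm_apply _ _
  rw [hw, one_smul] at h1
  rw [(OneDim.toComplex φ).map_smul, hw, smul_eq_mul, mul_one, one_smul] at h2
  exact h1.symm.trans (h.trans h2)

/-- The generator generates. -/
theorem eq_top_of_w_mem (N : LieSubmodule ℂ g (InducedModule φ)) (hw : w φ ∈ N) : N = ⊤ := by
  rw [eq_top_iff]
  rintro v -
  obtain ⟨t, rfl⟩ := (balancingSubmodule φ).mkQ_surjective v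
  induction t with
  | zero => rw [map_zero]; exact N.zero_mem
  | add s t hs ht => rw [map_add]; exact N.add_mem hs ht
  | tmul u c =>
    rw [mk_tmul]
    exact N.smul_mem _ (UniversalEnvelopingAlgebra.smul_mem_of_forall_ι N.toSubmodule
      (fun x v hv => N.lie_mem hv) u hw)

end InducedModule

/-! ### Uniqueness of the character -/

section Uniqueness

variable {p : LieSubalgebra ℂ g}

/-- The vectors of `g` that `n` brackets with elements of `p` bring into `p`. -/
def bracketFiltration (p : LieSubalgebra ℂ g) : ℕ → Submodule ℂ g
  | 0 => p.toSubmodule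
  | n + 1 => ⨅ x : p, (bracketFiltration p n).comap (LieAlgebra.ad ℂ g x)

theorem mem_bracketFiltration_succ {n : ℕ} {z : g} :
    z ∈ bracketFiltration p (n + 1) ↔ ∀ x : p, ⁅(x : g), z⁆ ∈ bracketFiltration p n := by
  simp [bracketFiltration]

variable {V : Type} [AddCommGroup V] [Module ℂ V] [LieRingModule g V] [LieModule ℂ g V]

/-- The vectors annihilated by any product of `n` operators `x - φ x` with `x` in `p`. -/
def nilpotentFiltration (φ : LieAlgebra.LieCharacter ℂ p) (V : Type) [AddCommGroup V] [Module ℂ V]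
    [LieRingModule g V] [LieModule ℂ g V] : ℕ → Submodule ℂ V
  | 0 => ⊥
  | n + 1 => ⨅ x : p, (nilpotentFiltration φ V n).comap
      (LieModule.toEnd ℂ g V x - φ x • LinearMap.id)

variable {φ : LieAlgebra.LieCharacter ℂ p}

theorem mem_nilpotentFiltration_succ {n : ℕ} {v : V} :
    v ∈ nilpotentFiltration φ V (n + 1) ↔
      ∀ x : p, ⁅(x : g), v⁆ - φ x • v ∈ nilpotentFiltration φ V n := by
  simp [nilpotentFiltration]

theorem nilpotentFiltration_mono : Monotone (nilpotentFiltration φ V) := by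
  refine monotone_nat_of_le_succ fun n => ?_
  induction n with
  | zero => exact bot_le
  | succ n ih =>
    intro v hv
    rw [mem_nilpotentFiltration_succ] at hv ⊢
    exact fun x => ih (hv x)

/-- Double induction on `d` and `k`. It makes the union of the nilpotent filtration stable under `g`
as soon as the bracket filtration exhausts `g`. -/
theorem exists_lie_mem_nilpotentFiltration (d k : ℕ) :
    ∃ k', ∀ z ∈ bracketFiltration p d, ∀ v ∈ nilpotentFiltration φ V k,
      ⁅z, v⁆ ∈ nilpotentFiltration φ V k' := by
  induction d generalizing k with
  | zero =>
    refine ⟨k, fun z hz v hv => ?_⟩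
    cases k with
    | zero =>
      obtain rfl : v = 0 := hv
      rw [lie_zero]
      exact Submodule.zero_mem _
    | succ k =>
      -- For `z` in `p`, write `z v = (z - φ z) v + φ z v`.
      have h := nilpotentFiltration_mono k.le_succ (mem_nilpotentFiltration_succ.mp hv ⟨z, hz⟩)
      simpa using Submodule.add_mem _ h (Submodule.smul_mem _ (φ ⟨z, hz⟩) hv)
  | succ d ihd =>
    induction k with
    | zero =>
      refine ⟨0, fun z _ v hv => ?_⟩
      obtain rfl : v = 0 := hv
      rw [lie_zero]
      exact Submodule.zero_mem _
    | succ k ihk =>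
      obtain ⟨a, ha⟩ := ihd (k + 1)
      obtain ⟨b, hb⟩ := ihk
      refine ⟨max a b + 1, fun z hz v hv => mem_nilpotentFiltration_succ.mpr fun x => ?_⟩
      -- The operator `x - φ x` commutes past `z` at the cost of `⁅x, z⁆`. The first term has
      -- smaller `d`, the second smaller `k`.
      have e : ⁅(x : g), ⁅z, v⁆⁆ - φ x • ⁅z, v⁆ =
          ⁅⁅(x : g), z⁆, v⁆ + ⁅z, ⁅(x : g), v⁆ - φ x • v⁆ := by
        rw [leibniz_lie, lie_sub, lie_smul]
        abel
      rw [e]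
      exact Submodule.add_mem _
        (nilpotentFiltration_mono (le_max_left a b)
          (ha _ (mem_bracketFiltration_succ.mp hz x) _ hv))
        (nilpotentFiltration_mono (le_max_right a b)
          (hb _ hz _ (mem_nilpotentFiltration_succ.mp hv x)))

/-- In a module generated by an eigenvector of `p` with character `φ`, all eigenvectors of `p` have
character `φ`, provided that `p` acts nilpotently on `g` modulo `p`. -/
theorem character_eq_of_eigenvector (hp : ∀ z : g, ∃ d, z ∈ bracketFiltration p d) {w : V}
    (hw : ∀ x : p, ⁅(x : g), w⁆ = φ x • w) (hgen : ∀ N : LieSubmodule ℂ g V, w ∈ N → N = ⊤)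
    {φ' : LieAlgebra.LieCharacter ℂ p} {v : V} (hv0 : v ≠ 0)
    (hv : ∀ x : p, ⁅(x : g), v⁆ = φ' x • v) : φ' = φ := by
  let N : LieSubmodule ℂ g V :=
    { toSubmodule := ⨆ n, nilpotentFiltration φ V n
      lie_mem := fun {z m} hm => by
        replace hm : m ∈ ⨆ n, nilpotentFiltration φ V n := hm
        change ⁅z, m⁆ ∈ ⨆ n, nilpotentFiltration φ V n
        rw [Submodule.mem_iSup_of_directed _ nilpotentFiltration_mono.directed_le] at hm ⊢
        obtain ⟨k, hk⟩ := hm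
        obtain ⟨d, hd⟩ := hp z
        obtain ⟨k', hk'⟩ := exists_lie_mem_nilpotentFiltration (φ := φ) (V := V) d k
        exact ⟨k', hk' z hd m hk⟩ }
  have hwN : w ∈ N := by
    refine Submodule.mem_iSup_of_mem 1 (mem_nilpotentFiltration_succ.mpr fun x => ?_)
    rw [hw, sub_self]
    exact Submodule.zero_mem _
  have hvN : v ∈ ⨆ n, nilpotentFiltration φ V n := by
    have : v ∈ N := hgen N hwN ▸ LieSubmodule.mem_top v
    exact this
  rw [Submodule.mem_iSup_of_directed _ nilpotentFiltration_mono.directed_le] at hvN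
  obtain ⟨n, hn⟩ := hvN
  ext x
  by_contra hne
  refine hv0 ?_
  -- If `φ' x ≠ φ x`, then `x - φ x` rescales `v` by a nonzero scalar while lowering its level by
  -- one, so `v` descends to level `0`, which is zero.
  induction n with
  | zero => exact hn
  | succ n ih =>
    refine ih ?_
    have h := mem_nilpotentFiltration_succ.mp hn x
    rw [hv, ← sub_smul] at h
    exact (Submodule.smul_mem_iff _ (sub_ne_zero.mpr hne)).mp h

end Uniqueness

end General
end

noncomputable section

/-! ### Graded Lie algebras with a homogeneous basis -/

section Graded

variable {g : Type} [LieRing g] [LieAlgebra ℂ g] {ι : Type} (b : Module.Basis ι ℂ g) (deg : ι → ℤ)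

/-- The bracket of two basis vectors is homogeneous of the expected degree. -/
def IsHomogeneousBasis : Prop :=
  ∀ i j, ⁅b i, b j⁆ ∈ Submodule.span ℂ (b '' {k | deg k = deg i + deg j})

variable {b deg}

/-- The subalgebra spanned by the basis vectors of degree at most `0`. -/
def nonpositivePart (h : IsHomogeneousBasis b deg) : LieSubalgebra ℂ g where
  toSubmodule := Submodule.span ℂ (b '' {i | deg i ≤ 0})
  lie_mem' hx hy := by
    refine lie_mem_span_of_forall ?_ hx hy
    rintro _ ⟨i, hi, rfl⟩ _ ⟨j, hj, rfl⟩
    refine Submodule.span_mono (Set.image_mono fun k hk => ?_) (h i j)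
    simp only [Set.mem_ofPred_eq] at hi hj hk ⊢
    omega

theorem isCompl_nonpositivePart (h : IsHomogeneousBasis b deg) {p : LieSubalgebra ℂ g}
    (hp : p.toSubmodule = Submodule.span ℂ (b '' {i | 1 ≤ deg i})) :
    IsCompl (nonpositivePart h).toSubmodule p.toSubmodule := by
  rw [hp]
  change IsCompl (Submodule.span ℂ (b '' {i | deg i ≤ 0})) _
  constructor
  · refine b.linearIndependent.disjoint_span_image (Set.disjoint_left.mpr fun i hi hi' => ?_)
    simp only [Set.mem_ofPred_eq] at hi hi'
    omega
  · rw [codisjoint_iff, ← Submodule.span_union, ← Set.image_union, eq_top_iff, ← b.span_eq]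
    refine Submodule.span_mono ?_
    rintro _ ⟨i, rfl⟩
    refine ⟨i, ?_, rfl⟩
    simp only [Set.mem_union, Set.mem_ofPred_eq]
    omega

/-- Each bracket with an element of `p` raises the degree by at least `1`, and degree at least `1`
means membership in `p`. -/
theorem basis_mem_bracketFiltration (h : IsHomogeneousBasis b deg) {p : LieSubalgebra ℂ g}
    (hp : p.toSubmodule = Submodule.span ℂ (b '' {i | 1 ≤ deg i})) (d : ℕ) (i : ι)
    (hi : 1 - (d : ℤ) ≤ deg i) : b i ∈ bracketFiltration p d := by
  induction d generalizing i with
  | zero =>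
    change b i ∈ p.toSubmodule
    rw [hp]
    refine Submodule.subset_span ⟨i, ?_, rfl⟩
    simpa using hi
  | succ d ih =>
    refine mem_bracketFiltration_succ.mpr ?_
    rintro ⟨x, hx⟩
    change ⁅x, b i⁆ ∈ _
    replace hx : x ∈ Submodule.span ℂ (b '' {i | 1 ≤ deg i}) := hp ▸ hx
    induction hx using Submodule.span_induction with
    | zero => rw [zero_lie]; exact Submodule.zero_mem _
    | add x y _ _ hx hy => rw [add_lie]; exact Submodule.add_mem _ hx hy
    | smul r x _ hx => rw [smul_lie]; exact Submodule.smul_mem _ _ hx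
    | mem x hx =>
      obtain ⟨j, hj, rfl⟩ := hx
      refine Submodule.span_le.mpr ?_ (h j i)
      rintro _ ⟨k, hk, rfl⟩
      refine ih k ?_
      simp only [Set.mem_ofPred_eq] at hj hk
      push_cast at hi
      omega

theorem exists_mem_bracketFiltration (h : IsHomogeneousBasis b deg) {p : LieSubalgebra ℂ g}
    (hp : p.toSubmodule = Submodule.span ℂ (b '' {i | 1 ≤ deg i})) (z : g) :
    ∃ d, z ∈ bracketFiltration p d := by
  have mono : Monotone (bracketFiltration p) := by
    refine monotone_nat_of_le_succ fun n => ?_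
    induction n with
    | zero => exact fun x hx => mem_bracketFiltration_succ.mpr fun y => p.lie_mem y.2 hx
    | succ n ih =>
      intro x hx
      rw [mem_bracketFiltration_succ] at hx ⊢
      exact fun y => ih (hx y)
  rw [← Submodule.mem_iSup_of_directed _ mono.directed_le]
  suffices ht : (⊤ : Submodule ℂ g) ≤ ⨆ d, bracketFiltration p d from ht Submodule.mem_top
  rw [← b.span_eq, Submodule.span_le]
  rintro _ ⟨i, rfl⟩
  -- For positive degrees `toNat` truncates to `0`, which is right, as the vector already lies in
  -- `p`.
  exact Submodule.mem_iSup_of_mem (1 - deg i).toNat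
    (basis_mem_bracketFiltration h hp _ i (by omega))

theorem InducedModule.w_ne_zero (h : IsHomogeneousBasis b deg) {p : LieSubalgebra ℂ g}
    (hp : p.toSubmodule = Submodule.span ℂ (b '' {i | 1 ≤ deg i}))
    (φ : LieAlgebra.LieCharacter ℂ p) : InducedModule.w φ ≠ 0 := by
  obtain ⟨Ψ, h1, -⟩ := exists_realization (isCompl_nonpositivePart h hp) φ
  intro h0
  rw [h0, map_zero] at h1
  -- The augmentation `U(q) → ℂ` shows that `1 ≠ 0` in `U(q)`.
  have := congrArg (UniversalEnvelopingAlgebra.lift ℂ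
    (0 : LieAlgebra.LieCharacter ℂ (nonpositivePart h))) h1
  rw [map_zero, map_one] at this
  exact zero_ne_one this

/-- The character is determined by the induced module. -/
theorem InducedModule.nonempty_equiv_iff (h : IsHomogeneousBasis b deg) {p : LieSubalgebra ℂ g}
    (hp : p.toSubmodule = Submodule.span ℂ (b '' {i | 1 ≤ deg i}))
    (φ φ' : LieAlgebra.LieCharacter ℂ p) :
    Nonempty (InducedModule φ ≃ₗ⁅ℂ, g⁆ InducedModule φ') ↔ φ = φ' := by
  constructor
  · rintro ⟨f⟩
    refine character_eq_of_eigenvector (exists_mem_bracketFiltration h hp)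
      (InducedModule.lie_w φ') (InducedModule.eq_top_of_w_mem φ') (v := f (InducedModule.w φ))
      (fun h0 => InducedModule.w_ne_zero h hp φ (f.injective (h0.trans (map_zero f).symm)))
      fun x => ?_
    rw [← LieModuleEquiv.coe_toLieModuleHom, ← LieModuleHom.map_lie, InducedModule.lie_w, map_smul]
  · rintro rfl
    exact ⟨LieModuleEquiv.refl⟩

end Graded

/-! ### The planar Galilean conformal algebra and its central extension -/

/-- The degree of a basis vector. -/
def PGIndex.deg : PGIndex → ℤ
  | .L m => m
  | .H m => m
  | .I m => m
  | .J m => m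

/-- The basis of the planar Galilean conformal algebra. -/
def PG.basis : Module.Basis PGIndex ℂ PG :=
  (Finsupp.basisSingleOne : Module.Basis PGIndex ℂ (PGIndex →₀ ℂ))

theorem PG.basis_apply (a : PGIndex) : PG.basis a = PG.vec a :=
  congrFun Finsupp.coe_basisSingleOne a

theorem PG.isHomogeneousBasis : IsHomogeneousBasis PG.basis PGIndex.deg := by
  intro a b
  have key (c : PGIndex) (hc : c.deg = a.deg + b.deg) :
      PG.vec c ∈ Submodule.span ℂ (PG.basis '' {k | k.deg = a.deg + b.deg}) :=
    Submodule.subset_span ⟨c, hc, PG.basis_apply c⟩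
  generalize Submodule.span ℂ (PG.basis '' {k | k.deg = a.deg + b.deg}) = S at key ⊢
  rw [PG.basis_apply, PG.basis_apply, PG.lie_vec]
  cases a <;> cases b <;> simp only [PG.br] <;>
    (try apply Submodule.neg_mem) <;> (try apply Submodule.smul_mem) <;>
    first
    | exact Submodule.zero_mem _
    | exact key _ rfl
    | exact key _ (add_comm _ _)

theorem PGPos_toSubmodule :
    PGPos.toSubmodule = Submodule.span ℂ (PG.basis '' {a | 1 ≤ a.deg}) := by
  change Submodule.span ℂ PG.positiveVectors = _
  congr 1
  ext x
  constructor
  · rintro ⟨m, hm, rfl | rfl | rfl | rfl⟩ <;> exact ⟨_, hm, PG.basis_apply _⟩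
  · rintro ⟨a, ha, rfl⟩
    rw [PG.basis_apply]
    refine ⟨a.deg, ha, ?_⟩
    cases a
    · exact .inl rfl
    · exact .inr (.inl rfl)
    · exact .inr (.inr (.inl rfl))
    · exact .inr (.inr (.inr rfl))

/-- The degree of a basis vector; the central elements have degree `0`. -/
def CPGIndex.deg : CPGIndex → ℤ
  | .L m => m
  | .H m => m
  | .I m => m
  | .J m => m
  | .C _ => 0

/-- The basis of the central extension. -/
def CPG.basis : Module.Basis CPGIndex ℂ CPG :=
  (Finsupp.basisSingleOne : Module.Basis CPGIndex ℂ (CPGIndex →₀ ℂ))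

theorem CPG.basis_apply (a : CPGIndex) : CPG.basis a = CPG.vec a :=
  congrFun Finsupp.coe_basisSingleOne a

/-- Central terms occur only when the degrees are opposite and nonzero: the Kronecker delta forces
the sum `0`, and the factors `n ^ 3`, `n ^ 2`, `n` vanish at `n = 0`. The lemma serves both
homogeneity of the basis and the vanishing of central functionals on brackets. -/
theorem CPG.lie_vec_mem {S : Submodule ℂ CPG} {a b : CPGIndex}
    (hS : ∀ c, c.deg = a.deg + b.deg → (∀ s, c ≠ .C s) → CPG.vec c ∈ S)
    (hC : a.deg + b.deg = 0 → a.deg ≠ 0 → ∀ s, CPG.C s ∈ S) : ⁅CPG.vec a, CPG.vec b⁆ ∈ S := by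
  have hδ (n m : ℤ) (k : ℕ) (hk : k ≠ 0) (s : Fin 3) (h : n + m = 0 → n ≠ 0 → ∀ s, CPG.C s ∈ S) :
      ((n : ℂ) ^ k * CPG.δ (m + n)) • CPG.C s ∈ S := by
    by_cases hn : n = 0
    · rw [hn, Int.cast_zero, zero_pow hk, zero_mul, zero_smul]
      exact S.zero_mem
    · by_cases hm : m + n = 0
      · exact S.smul_mem _ (h ((add_comm _ _).trans hm) hn s)
      · rw [CPG.δ, if_neg hm, mul_zero, zero_smul]
        exact S.zero_mem
  rcases a with n | n | n | n | s <;> rcases b with m | m | m | m | t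
  · change ⁅CPG.L n, CPG.L m⁆ ∈ S
    rw [CPG.lie_LL]
    exact S.add_mem (S.smul_mem _ (hS (.L _) (add_comm _ _) (by simp))) (hδ n m 3 (by simp) _ hC)
  · change ⁅CPG.L n, CPG.H m⁆ ∈ S
    rw [CPG.lie_LH]
    exact S.add_mem (S.smul_mem _ (hS (.H _) (add_comm _ _) (by simp))) (hδ n m 2 (by simp) _ hC)
  · change ⁅CPG.L n, CPG.I m⁆ ∈ S
    rw [CPG.lie_LI]
    exact S.smul_mem _ (hS (.I _) (add_comm _ _) (by simp))
  · change ⁅CPG.L n, CPG.J m⁆ ∈ S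
    rw [CPG.lie_LJ]
    exact S.smul_mem _ (hS (.J _) (add_comm _ _) (by simp))
  · change ⁅CPG.L n, CPG.C t⁆ ∈ S
    rw [CPG.lie_C]
    exact S.zero_mem
  · change ⁅CPG.H n, CPG.L m⁆ ∈ S
    rw [← lie_skew, CPG.lie_LH]
    refine S.neg_mem (S.add_mem (S.smul_mem _ (hS (.H _) rfl (by simp)))
      (hδ m n 2 (by simp) _ fun h h' => hC ((add_comm _ _).trans h) ?_))
    change n ≠ 0
    omega
  · change ⁅CPG.H n, CPG.H m⁆ ∈ S
    rw [CPG.lie_HH, ← pow_one (n : ℂ)]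
    exact hδ n m 1 one_ne_zero _ hC
  · change ⁅CPG.H n, CPG.I m⁆ ∈ S
    rw [CPG.lie_HI]
    exact hS (.I _) (add_comm _ _) (by simp)
  · change ⁅CPG.H n, CPG.J m⁆ ∈ S
    rw [CPG.lie_HJ]
    exact S.neg_mem (hS (.J _) (add_comm _ _) (by simp))
  · change ⁅CPG.H n, CPG.C t⁆ ∈ S
    rw [CPG.lie_C]
    exact S.zero_mem
  · change ⁅CPG.I n, CPG.L m⁆ ∈ S
    rw [← lie_skew, CPG.lie_LI]
    exact S.neg_mem (S.smul_mem _ (hS (.I _) rfl (by simp)))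
  · change ⁅CPG.I n, CPG.H m⁆ ∈ S
    rw [← lie_skew, CPG.lie_HI]
    exact S.neg_mem (hS (.I _) rfl (by simp))
  · change ⁅CPG.I n, CPG.I m⁆ ∈ S
    rw [CPG.lie_II]
    exact S.zero_mem
  · change ⁅CPG.I n, CPG.J m⁆ ∈ S
    rw [CPG.lie_IJ]
    exact S.zero_mem
  · change ⁅CPG.I n, CPG.C t⁆ ∈ S
    rw [CPG.lie_C]
    exact S.zero_mem
  · change ⁅CPG.J n, CPG.L m⁆ ∈ S
    rw [← lie_skew, CPG.lie_LJ]
    exact S.neg_mem (S.smul_mem _ (hS (.J _) rfl (by simp)))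
  · change ⁅CPG.J n, CPG.H m⁆ ∈ S
    rw [← lie_skew, CPG.lie_HJ]
    exact S.neg_mem (S.neg_mem (hS (.J _) rfl (by simp)))
  · change ⁅CPG.J n, CPG.I m⁆ ∈ S
    rw [← lie_skew, CPG.lie_IJ, neg_zero]
    exact S.zero_mem
  · change ⁅CPG.J n, CPG.J m⁆ ∈ S
    rw [CPG.lie_JJ]
    exact S.zero_mem
  · change ⁅CPG.J n, CPG.C t⁆ ∈ S
    rw [CPG.lie_C]
    exact S.zero_mem
  all_goals
    rw [← lie_skew]
    change -⁅_, CPG.C s⁆ ∈ S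
    rw [CPG.lie_C, neg_zero]
    exact S.zero_mem

theorem CPG.isHomogeneousBasis : IsHomogeneousBasis CPG.basis CPGIndex.deg := by
  intro a b
  rw [CPG.basis_apply, CPG.basis_apply]
  exact CPG.lie_vec_mem (fun c hc _ => Submodule.subset_span ⟨c, hc, CPG.basis_apply c⟩)
    fun h _ s => Submodule.subset_span ⟨.C s, h.symm, CPG.basis_apply _⟩

theorem CPGPos_toSubmodule :
    CPGPos.toSubmodule = Submodule.span ℂ (CPG.basis '' {a | 1 ≤ a.deg}) := by
  change Submodule.span ℂ CPG.positiveVectors = _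
  congr 1
  ext x
  constructor
  · rintro ⟨m, hm, rfl | rfl | rfl | rfl⟩ <;> exact ⟨_, hm, CPG.basis_apply _⟩
  · rintro ⟨a, ha, rfl⟩
    rw [CPG.basis_apply]
    refine ⟨a.deg, ha, ?_⟩
    cases a
    · exact .inl rfl
    · exact .inr (.inl rfl)
    · exact .inr (.inr (.inl rfl))
    · exact .inr (.inr (.inr rfl))
    · exact absurd (show (1 : ℤ) ≤ 0 from ha) (by norm_num)

/-! ### Characters of the nonpositive part with prescribed central values. -/

/-- The linear functional with value `ξ s` at `C s` that vanishes at the other basis vectors. -/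
def CPG.centralFunctional (ξ : Fin 3 → ℂ) : CPG →ₗ[ℂ] ℂ :=
  CPG.basis.constr ℂ fun
    | .C s => ξ s
    | _ => 0

theorem CPG.centralFunctional_vec (ξ : Fin 3 → ℂ) (a : CPGIndex) :
    CPG.centralFunctional ξ (CPG.vec a) = match a with
      | .C s => ξ s
      | _ => 0 := by
  rw [← CPG.basis_apply, CPG.centralFunctional, Module.Basis.constr_basis]

/-- Two nonpositive degrees cannot be opposite and nonzero, so brackets inside the nonpositive part
have no central component. This is what makes the functional a character there. -/
theorem CPG.centralFunctional_lie (ξ : Fin 3 → ℂ) {x y : CPG}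
    (hx : x ∈ Submodule.span ℂ (CPG.basis '' {a | a.deg ≤ 0}))
    (hy : y ∈ Submodule.span ℂ (CPG.basis '' {a | a.deg ≤ 0})) :
    CPG.centralFunctional ξ ⁅x, y⁆ = 0 := by
  induction hx, hy using Submodule.span_induction₂ with
  | zero_left y hy => rw [zero_lie, map_zero]
  | zero_right x hx => rw [lie_zero, map_zero]
  | add_left x y z _ _ _ h₁ h₂ => rw [add_lie, map_add, h₁, h₂, add_zero]
  | add_right x y z _ _ _ h₁ h₂ => rw [lie_add, map_add, h₁, h₂, add_zero]
  | smul_left r x y _ _ h => rw [smul_lie, map_smul, h, smul_zero]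
  | smul_right r x y _ _ h => rw [lie_smul, map_smul, h, smul_zero]
  | mem_mem x y hx hy =>
    obtain ⟨a, ha, rfl⟩ := hx
    obtain ⟨b, hb, rfl⟩ := hy
    rw [CPG.basis_apply, CPG.basis_apply]
    refine CPG.lie_vec_mem (S := LinearMap.ker (CPG.centralFunctional ξ)) (fun c _ hc => ?_)
      fun h h' _ => absurd h ?_
    · rw [LinearMap.mem_ker, CPG.centralFunctional_vec]
      cases c with
      | C s => exact absurd rfl (hc s)
      | _ => rfl
    · simp only [Set.mem_ofPred_eq] at ha hb
      omega

attribute [local instance 100] LieRing.ofAssociativeRing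

/-- The character of the nonpositive part with value `ξ s` at `C s` that vanishes at the other
basis vectors. -/
def CPG.centralCharacter (ξ : Fin 3 → ℂ) :
    LieAlgebra.LieCharacter ℂ (nonpositivePart CPG.isHomogeneousBasis) :=
  { CPG.centralFunctional ξ ∘ₗ (nonpositivePart CPG.isHomogeneousBasis).toSubmodule.subtype with
    map_lie' := fun {x y} => by
      rw [LieRing.of_associative_ring_bracket, mul_comm, sub_self]
      exact CPG.centralFunctional_lie ξ x.2 y.2 }

/-- The functional `ε ∘ Ψ` separates the generator from the submodule: `C s` lies in the nonpositive
part, so `Ψ` turns its action into left multiplication, which `ε` turns into the scalar `ξ s`; the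
generator goes to `1`. -/
theorem w_notMem_centralSubmodule (φ : LieAlgebra.LieCharacter ℂ CPGPos) (ξ : Fin 3 → ℂ) :
    InducedModule.w φ ∉ centralSubmodule φ ξ := by
  obtain ⟨Ψ, h1, hΨ⟩ :=
    exists_realization (isCompl_nonpositivePart CPG.isHomogeneousBasis CPGPos_toSubmodule) φ
  let ε := UniversalEnvelopingAlgebra.lift ℂ (CPG.centralCharacter ξ)
  have hle : (centralSubmodule φ ξ).toSubmodule ≤ LinearMap.ker (ε.toLinearMap ∘ₗ Ψ) := by
    refine iSup_le fun s => ?_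
    rintro _ ⟨v, rfl⟩
    have hC : CPG.C s ∈ nonpositivePart CPG.isHomogeneousBasis :=
      Submodule.subset_span ⟨.C s, le_refl (0 : ℤ), CPG.basis_apply _⟩
    have hε : CPG.centralCharacter ξ ⟨CPG.C s, hC⟩ = ξ s := CPG.centralFunctional_vec ξ (.C s)
    change ε (Ψ (⁅CPG.C s, v⁆ - ξ s • v)) = 0
    rw [map_sub, map_smul, hΨ ⟨CPG.C s, hC⟩ v, map_sub, map_mul, map_smul,
      UniversalEnvelopingAlgebra.lift_ι_apply, hε, smul_eq_mul, sub_self]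
  intro hw
  have h0 : ε (Ψ (InducedModule.w φ)) = 0 := hle hw
  rw [h1, map_one] at h0
  exact one_ne_zero h0

/-! ### The quotients with fixed central values. -/

/-- The generator of `L̃_{φ,ξ}`. -/
def WhittakerLTilde.w (φ : LieAlgebra.LieCharacter ℂ CPGPos) (ξ : Fin 3 → ℂ) :
    WhittakerLTilde φ ξ :=
  LieSubmodule.Quotient.mk' (centralSubmodule φ ξ) (InducedModule.w φ)

namespace WhittakerLTilde

variable (φ : LieAlgebra.LieCharacter ℂ CPGPos) (ξ : Fin 3 → ℂ)

theorem w_ne_zero : w φ ξ ≠ 0 := fun h =>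
  w_notMem_centralSubmodule φ ξ ((LieSubmodule.Quotient.mk_eq_zero (N := centralSubmodule φ ξ)).mp h)

theorem lie_w (x : CPGPos) : ⁅(x : CPG), w φ ξ⁆ = φ x • w φ ξ := by
  rw [w, ← LieModuleHom.map_lie, InducedModule.lie_w, map_smul]

theorem eq_top_of_w_mem (N : LieSubmodule ℂ CPG (WhittakerLTilde φ ξ)) (hw : w φ ξ ∈ N) :
    N = ⊤ := by
  have h := InducedModule.eq_top_of_w_mem φ
    (N.comap (LieSubmodule.Quotient.mk' (centralSubmodule φ ξ))) hw
  rw [eq_top_iff]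
  rintro v -
  obtain ⟨v, rfl⟩ := LieSubmodule.Quotient.surjective_mk' (centralSubmodule φ ξ) v
  exact LieSubmodule.mem_comap.mp (h ▸ LieSubmodule.mem_top v)

theorem lie_C (s : Fin 3) (v : WhittakerLTilde φ ξ) : ⁅CPG.C s, v⁆ = ξ s • v := by
  obtain ⟨v, rfl⟩ := LieSubmodule.Quotient.surjective_mk' (centralSubmodule φ ξ) v
  rw [← LieModuleHom.map_lie, ← map_smul, ← sub_eq_zero, ← map_sub]
  refine (LieSubmodule.Quotient.mk_eq_zero (N := centralSubmodule φ ξ)).mpr ?_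
  exact Submodule.mem_iSup_of_mem s ⟨v, rfl⟩

end WhittakerLTilde

end

/-! ### The three isomorphism criteria. -/

theorem mainTheorem6 :
    (∀ φ φ' : LieAlgebra.LieCharacter ℂ PGPos,
      Nonempty (WhittakerM φ ≃ₗ⁅ℂ, PG⁆ WhittakerM φ') ↔ φ = φ') ∧
    (∀ φ φ' : LieAlgebra.LieCharacter ℂ CPGPos,
      Nonempty (WhittakerMTilde φ ≃ₗ⁅ℂ, CPG⁆ WhittakerMTilde φ') ↔ φ = φ') ∧
    (∀ (φ φ' : LieAlgebra.LieCharacter ℂ CPGPos) (ξ ξ' : Fin 3 → ℂ),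
      Nonempty (WhittakerLTilde φ ξ ≃ₗ⁅ℂ, CPG⁆ WhittakerLTilde φ' ξ') ↔ φ = φ' ∧ ξ = ξ') := by
  refine ⟨InducedModule.nonempty_equiv_iff PG.isHomogeneousBasis PGPos_toSubmodule,
    InducedModule.nonempty_equiv_iff CPG.isHomogeneousBasis CPGPos_toSubmodule,
    fun φ φ' ξ ξ' => ⟨?_, ?_⟩⟩
  · rintro ⟨f⟩
    have hf : f (WhittakerLTilde.w φ ξ) ≠ 0 := fun h0 =>
      WhittakerLTilde.w_ne_zero φ ξ (f.injective (h0.trans (map_zero f).symm))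
    constructor
    · refine character_eq_of_eigenvector
        (exists_mem_bracketFiltration CPG.isHomogeneousBasis CPGPos_toSubmodule)
        (WhittakerLTilde.lie_w φ' ξ') (WhittakerLTilde.eq_top_of_w_mem φ' ξ') hf fun x => ?_
      rw [← LieModuleEquiv.coe_toLieModuleHom, ← LieModuleHom.map_lie, WhittakerLTilde.lie_w, map_smul]
    · funext s
      -- On the nonzero vector `f w`, the element `C s` acts by `ξ' s` in the target and, by
      -- equivariance of `f`, also by `ξ s`.
      have h := WhittakerLTilde.lie_C φ' ξ' s (f (WhittakerLTilde.w φ ξ))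
      rw [← LieModuleEquiv.coe_toLieModuleHom, ← LieModuleHom.map_lie, WhittakerLTilde.lie_C, map_smul] at h
      exact smul_left_injective ℂ hf h
  · rintro ⟨rfl, rfl⟩
    exact ⟨LieModuleEquiv.refl⟩
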